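/- **Lemma (binary case).** Let $(h_i,y_i)_{i=1}^n$, $n\ge 1$, be training data with $h_i\in\mathbb R^d$ and labels $y_i\in\{1,2\}$; put $\upsilon_i=1$ if $y_i=1$ and $\upsilon_i=-1$ if $y_i=2$. Assume the data are linearly separable: there is $w\in\mathbb R^d$ with $\upsilon_i w^Th_i>0$ for all $i$. Let $\delta_1,\delta_2>0$, and let $\omega_1,\omega_2>0$, $\iota_1,\iota_2\in\mathbb R$. For $W=[w_1,w_2]\in\mathbb R^{d\times 2}$ and $w\in\mathbb R^d$ consider the unregularized losses $$L_{\mathrm{CDT}}(W)=\sum_i\log\Big(1+\sum_{c\ne y_i}e^{-(\delta_{y_i}w_{y_i}-\delta_cw_c)^Th_i}\Big),\qquad L_{\mathrm{LDT}}(W)=\sum_i\log\Big(1+\sum_{c\ne y_i}e^{-\delta_{y_i}(w_{y_i}-w_c)^Th_i}\Big),$$ $$L_{\mathrm{CE}}(w)=\sum_i\log\big(1+e^{-\upsilon_iw^Th_i}\big),\qquad L_{\mathrm{VS}}(w)=\sum_i\omega_{y_i}\log\big(1+e^{\iota_{y_i}}e^{-\upsilon_i\delta_{y_i}w^Th_i}\big)$$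 (so the binary VS loss has the same multiplicative parameters as LDT: $\delta_1$ for $\upsilon=1$ and $\delta_2$ for $\upsilon=-1$; the case $\omega\equiv1$, $\iota\equiv0$ is the purely multiplicative one). Parameter spaces carry the Euclidean (Frobenius) norm. Say that minimizing a loss $L$ *produces* the classifier $v$ if both of the following hold. - There are step sizes $\eta$ with $0<\eta<2/K$ for some Lipschitz constant $K$ of $\nabla L$, and for every such $\eta$ and every starting point the gradient descent iterates $w(t)$ satisfy $L(w(t))\to\inf L$, $\|w(t)\|\to\infty$ and $w(t)/\|w(t)\|\to v$. - $L$ has a minimizer over each ball $\{\|w\|\le R\}$, $R>0$, and for every choice $w_R$ of such minimizers $w_R/R\to v$ as $R\to\infty$. A two-class classifier $W=[w_1,w_2]$ assigns to $x\in\mathbb R^d$ the first class if $(w_1-w_2)^Tx>0$ and the second if $(w_1-w_2)^Tx<0$; a binary classifier $w$ assigns the first class ($\upsilon=1$) if $w^Tx>0$ and the second ($\upsilon=-1$) if $w^Tx<0$. Then minimizing each of the four losses produces a classifier, and: 1. the classifiers produced by $L_{\mathrm{LDT}}$ and $L_{\mathrm{VS}}$ have the same classification rule (and the same decision boundary); 2.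 for all $\delta_1,\delta_2>0$, the classifiers produced by $L_{\mathrm{CDT}}$ and $L_{\mathrm{CE}}$ have the same classification rule (and the same decision boundary). More precisely, each of the max-margin problems $$\min_W\|W\|_F^2\ \text{ s.t. }(\delta_{y_i}w_{y_i}-\delta_cw_c)^Th_i\ge1\ (c\ne y_i),\qquad \min_W\|W\|_F^2\ \text{ s.t. }\delta_{y_i}(w_{y_i}-w_c)^Th_i\ge1\ (c\ne y_i),$$ $$\min_w\|w\|^2\ \text{ s.t. }\upsilon_iw^Th_i\ge1,\qquad \min_w\|w\|^2\ \text{ s.t. }\upsilon_i\delta_{y_i}w^Th_i\ge1$$ (constraints for all $i$) has a unique solution, $W^{\mathrm{CDT}},W^{\mathrm{LDT}},w^{\mathrm{CE}},w^{\mathrm{VS}}$ respectively; the classifiers produced by $L_{\mathrm{CDT}},L_{\mathrm{LDT}},L_{\mathrm{CE}},L_{\mathrm{VS}}$ are these solutions divided by their norms; and $$W^{\mathrm{LDT}}=\big[\tfrac12w^{\mathrm{VS}},\,-\tfrac12w^{\mathrm{VS}}\big],\qquad W^{\mathrm{CDT}}=\Big[\tfrac{\delta_1}{\delta_1^2+\delta_2^2}w^{\mathrm{CE}},\,-\tfrac{\delta_2}{\delta_1^2+\delta_2^2}w^{\mathrm{CE}}\Big].$$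 -/

import Mathlib

open scoped InnerProductSpace

noncomputable section

/-- Feature vectors, with the Euclidean norm. -/
abbrev Feat (d : ℕ) : Type := EuclideanSpace ℝ (Fin d)

/-- Linear `k`-class classifiers: matrices `W = [w₁, …, w_k]` in `ℝ^{d × k}` given by their columns
`W c`, with the Frobenius norm and inner product. -/
abbrev Classifier (d k : ℕ) : Type := PiLp 2 (fun _ : Fin k => Feat d)

/-- The `±1` encoding of the two classes: class `1` (index `0`) is `+1`, class `2` (index `1`)
is `-1`. -/
def signLabel (c : Fin 2) : ℝ := if c = 0 then 1 else -1

/-! ### Training losses (no regularization) -/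

/-- The class-dependent-temperature (CDT) loss of a linear `k`-class model. -/
def cdtLoss {d k n : ℕ} (δ : Fin k → ℝ) (h : Fin n → Feat d) (y : Fin n → Fin k)
    (W : Classifier d k) : ℝ :=
  ∑ i, Real.log (1 + ∑ c ∈ Finset.univ.erase (y i),
    Real.exp (-⟪δ (y i) • W (y i) - δ c • W c, h i⟫_ℝ))

/-- The label-dependent-temperature (LDT) loss of a linear `k`-class model. -/
def ldtLoss {d k n : ℕ} (δ : Fin k → ℝ) (h : Fin n → Feat d) (y : Fin n → Fin k)
    (W : Classifier d k) : ℝ :=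
  ∑ i, Real.log (1 + ∑ c ∈ Finset.univ.erase (y i),
    Real.exp (-(δ (y i) * ⟪W (y i) - W c, h i⟫_ℝ)))

/-- The binary cross-entropy (logistic) loss. -/
def ceLoss {d n : ℕ} (h : Fin n → Feat d) (y : Fin n → Fin 2) (w : Feat d) : ℝ :=
  ∑ i, Real.log (1 + Real.exp (-(signLabel (y i) * ⟪w, h i⟫_ℝ)))

/-- The binary vector-scaling (VS) loss with multiplicative parameters `δ`, additive parameters
`ι` and class weights `ω`; the purely multiplicative loss is the case `ι = 0`, `ω = 1`. -/
def vsLoss {d n : ℕ} (δ ι ω : Fin 2 → ℝ) (h : Fin n → Feat d) (y : Fin n → Fin 2)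
    (w : Feat d) : ℝ :=
  ∑ i, ω (y i) * Real.log (1 + Real.exp (ι (y i)) *
    Real.exp (-(signLabel (y i) * δ (y i) * ⟪w, h i⟫_ℝ)))

/-! ### Minimizing an unregularized loss

On separable data the infimum of these losses is not attained, and what the minimization returns
is a direction. -/

section Minimization

variable {E : Type*} [NormedAddCommGroup E] [InnerProductSpace ℝ E] [CompleteSpace E]

/-- Gradient descent on `L` with constant step size `η`, started at `w₀`. -/
def gdIter (L : E → ℝ) (η : ℝ) (w₀ : E) : ℕ → E
  | 0 => w₀
  | t + 1 => gdIter L η w₀ t - η • gradient L (gdIter L η w₀ t)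

/-- The usual step-size condition: `0 < η < 2 / K` for a Lipschitz constant `K` of the gradient. -/
def AdmissibleStep (L : E → ℝ) (η : ℝ) : Prop :=
  0 < η ∧ ∃ K : NNReal, LipschitzWith K (gradient L) ∧ η * K < 2

/-- Admissible step sizes exist, and from every starting point and for every admissible step size,
gradient descent drives `L` to its infimum, diverges in norm, and converges in direction to `v`. -/
def IsGDDirection (L : E → ℝ) (v : E) : Prop :=
  (∃ η, AdmissibleStep L η) ∧
  ∀ (η : ℝ) (w₀ : E), AdmissibleStep L η →
    Filter.Tendsto (fun t => L (gdIter L η w₀ t)) Filter.atTop (nhds (⨅ w, L w)) ∧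
    Filter.Tendsto (fun t => ‖gdIter L η w₀ t‖) Filter.atTop Filter.atTop ∧
    Filter.Tendsto (fun t => ‖gdIter L η w₀ t‖⁻¹ • gdIter L η w₀ t) Filter.atTop (nhds v)

/-- `w` minimizes `L` over the ball of radius `R`. -/
def IsBallMin (L : E → ℝ) (R : ℝ) (w : E) : Prop :=
  w ∈ Metric.closedBall (0 : E) R ∧ IsMinOn L (Metric.closedBall (0 : E) R) w

/-- Minimizers of `L` over balls exist, and, scaled by the radius, they converge to `v` as the
norm constraint is lifted (`R → ∞`), however they are selected. -/
def IsPathDirection (L : E → ℝ) (v : E) : Prop :=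
  (∀ R : ℝ, 0 < R → ∃ w, IsBallMin L R w) ∧
  ∀ w : ℝ → E, (∀ R : ℝ, 0 < R → IsBallMin L R (w R)) →
    Filter.Tendsto (fun R : ℝ => R⁻¹ • w R) Filter.atTop (nhds v)

/-- `v` is the (unit-norm) classifier that minimizing `L` without regularization produces: the
limit direction both of gradient descent and of norm-constrained minimization. -/
def IsTrained (L : E → ℝ) (v : E) : Prop :=
  IsGDDirection L v ∧ IsPathDirection L v

/-- `w` is a minimum-norm point of the feasible set `S`. -/
def IsMinNorm (S : Set E) (w : E) : Prop :=
  w ∈ S ∧ ∀ v ∈ S, ‖w‖ ^ 2 ≤ ‖v‖ ^ 2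

end Minimization

/-! ### Feasible sets of the max-margin problems -/

def cdtFeasible {d k n : ℕ} (δ : Fin k → ℝ) (h : Fin n → Feat d) (y : Fin n → Fin k) :
    Set (Classifier d k) :=
  {W | ∀ i, ∀ c, c ≠ y i → 1 ≤ ⟪δ (y i) • W (y i) - δ c • W c, h i⟫_ℝ}

def ldtFeasible {d k n : ℕ} (δ : Fin k → ℝ) (h : Fin n → Feat d) (y : Fin n → Fin k) :
    Set (Classifier d k) :=
  {W | ∀ i, ∀ c, c ≠ y i → 1 ≤ δ (y i) * ⟪W (y i) - W c, h i⟫_ℝ}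

def ceFeasible {d n : ℕ} (h : Fin n → Feat d) (y : Fin n → Fin 2) : Set (Feat d) :=
  {w | ∀ i, 1 ≤ signLabel (y i) * ⟪w, h i⟫_ℝ}

def vsFeasible {d n : ℕ} (δ : Fin 2 → ℝ) (h : Fin n → Feat d) (y : Fin n → Fin 2) :
    Set (Feat d) :=
  {w | ∀ i, 1 ≤ signLabel (y i) * δ (y i) * ⟪w, h i⟫_ℝ}

/-! ### Classification rules -/

/-- Rule of a binary classifier: `1` (first class), `-1` (second class), `0` on the decision
boundary. -/
def binaryRule {d : ℕ} (w x : Feat d) : SignType := SignType.sign ⟪w, x⟫_ℝ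

/-- Rule of a two-class classifier `W = [w₁, w₂]`: the sign of `(w₁ - w₂)ᵀ x`. -/
def twoClassRule {d : ℕ} (W : Classifier d 2) (x : Feat d) : SignType :=
  SignType.sign ⟪W 0 - W 1, x⟫_ℝ

/-- Linear separability of the two classes (by a hyperplane through the origin). -/
def Separable {d n : ℕ} (h : Fin n → Feat d) (y : Fin n → Fin 2) : Prop :=
  ∃ w : Feat d, ∀ i, 0 < signLabel (y i) * ⟪w, h i⟫_ℝ

end

/-!
Both two-class losses are binary losses read through a linear map: the CDT loss is the CE loss at
`δ₁ w₁ - δ₂ w₂`, and the LDT loss is the VS loss with `ι = 0`, `ω = 1` at `w₁ - w₂`. The map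
`A W = p w₁ - q w₂` satisfies `A A* = (p² + q²) I`, so `(p² + q²)⁻¹ A* w` has minimum norm in the
preimage under `A` of any set in which `w` has minimum norm. It remains to minimize a weighted
logistic loss `L w = ∑ i, aᵢ log (1 + exp (bᵢ - ⟪w, xᵢ⟫))` on a Hilbert space. Let `v` be the
minimum-norm vector of unit margin, so that `‖v‖⁻¹` is the largest margin of a unit vector.

A small loss forces margins of at least `-log L w - O(1)`. Hence vectors whose norms `r` diverge
and which satisfy `log L w ≤ C - m r`, with `C` depending on `m`, for every `m < ‖v‖⁻¹`, converge in
direction to `v`. Minimizers over balls satisfy the bound by comparison with `R ‖v‖⁻¹ v`. Along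
gradient descent `∇L` tends to zero, so all margins diverge; then asymptotically
`L ≤ ‖v‖ ‖∇L‖`, while a step lowers `L` by `η ‖∇L‖²`. Thus each step lowers `log L` by `‖v‖⁻¹`
times its own length, and summing these decrements gives the bound again.
-/

open Filter Topology

/-! ### The softplus function -/

section Softplus

/-- The softplus function, the loss of a single example in logistic regression. -/
noncomputable def softplus (s : ℝ) : ℝ := Real.log (1 + Real.exp s)

theorem softplus_pos (s : ℝ) : 0 < softplus s :=
  Real.log_pos (lt_add_of_pos_right 1 (Real.exp_pos s))

theorem exp_softplus (s : ℝ) : Real.exp (softplus s) = 1 + Real.exp s :=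
  Real.exp_log (by positivity)

theorem softplus_le_exp (s : ℝ) : softplus s ≤ Real.exp s := by
  linarith [exp_softplus s, Real.add_one_le_exp (softplus s)]

theorem exp_le_two_mul_softplus {s : ℝ} (h : softplus s ≤ 1) :
    Real.exp s ≤ 2 * softplus s := by
  have hpos := softplus_pos s
  have hquad := (abs_le.1 (Real.abs_exp_sub_one_sub_id_le (abs_le.2 ⟨by linarith, h⟩))).2
  rw [exp_softplus] at hquad
  nlinarith

theorem tendsto_softplus_atBot : Tendsto softplus atBot (𝓝 0) :=
  squeeze_zero (fun s => (softplus_pos s).le) softplus_le_exp Real.tendsto_exp_atBot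

theorem one_add_exp_mul_sigmoid (s : ℝ) : (1 + Real.exp s) * Real.sigmoid s = Real.exp s := by
  rw [Real.sigmoid_def, Real.exp_neg]
  field_simp
  ring

theorem softplus_le_mul_sigmoid {s ε : ℝ} (h : Real.exp s ≤ ε) :
    softplus s ≤ (1 + ε) * Real.sigmoid s :=
  calc softplus s ≤ Real.exp s := softplus_le_exp s
    _ = (1 + Real.exp s) * Real.sigmoid s := (one_add_exp_mul_sigmoid s).symm
    _ ≤ (1 + ε) * Real.sigmoid s := by gcongr; exact Real.sigmoid_nonneg s

theorem hasDerivAt_softplus (s : ℝ) : HasDerivAt softplus (Real.sigmoid s) s := by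
  refine (((Real.hasDerivAt_exp s).const_add 1).log (by positivity)).congr_deriv ?_
  rw [div_eq_iff (by positivity), mul_comm, one_add_exp_mul_sigmoid]

theorem log_le_log_sub_of_le_mul {u v c : ℝ} (hu : 0 < u) (hv : 0 < v) (h : v ≤ u * (1 - c)) :
    Real.log v ≤ Real.log u - c := by
  have hlog := Real.log_le_sub_one_of_pos (div_pos hv hu)
  rw [Real.log_div hv.ne' hu.ne'] at hlog
  have hdiv : v / u ≤ 1 - c := (div_le_iff₀' hu).2 h
  linarith

theorem softplus_add_le (s r : ℝ) :
    softplus (s + r) ≤ softplus s + Real.sigmoid s * (Real.exp r - 1) := by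
  have hexp : 1 + Real.exp (s + r) =
      (1 + Real.exp s) * (1 - -(Real.sigmoid s * (Real.exp r - 1))) := by
    rw [Real.exp_add]
    linear_combination (1 - Real.exp r) * one_add_exp_mul_sigmoid s
  simpa only [softplus, sub_neg_eq_add] using
    log_le_log_sub_of_le_mul (by positivity) (by positivity) hexp.le

/-- The quadratic error carries the factor `sigmoid s`, hence is negligible where softplus is. -/
theorem softplus_add_le_of_abs_le_one (s : ℝ) {r : ℝ} (hr : |r| ≤ 1) :
    softplus (s + r) ≤ softplus s + Real.sigmoid s * (r + r ^ 2) := by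
  have hquad := (abs_le.1 (Real.abs_exp_sub_one_sub_id_le hr)).2
  refine (softplus_add_le s r).trans ?_
  gcongr
  · exact Real.sigmoid_nonneg s
  · linarith

theorem lipschitzWith_sigmoid : LipschitzWith 1 Real.sigmoid := by
  refine lipschitzWith_of_nnnorm_deriv_le differentiable_sigmoid fun s => ?_
  rw [← NNReal.coe_le_coe, coe_nnnorm, Real.deriv_sigmoid, Real.norm_eq_abs, NNReal.coe_one,
    abs_le]
  have hpos := Real.sigmoid_pos s
  have hlt := Real.sigmoid_lt_one s
  constructor <;> nlinarith

theorem tendsto_atBot_of_tendsto_sigmoid {α : Type*} {l : Filter α} {s : α → ℝ}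
    (h : Tendsto (fun t => Real.sigmoid (s t)) l (𝓝 0)) : Tendsto s l atBot :=
  tendsto_atBot.2 fun c => (h.eventually_lt_const (Real.sigmoid_pos c)).mono fun _ ht =>
    (Real.sigmoid_lt_iff.1 ht).le

end Softplus

/-! ### Gradient descent on a function with Lipschitz gradient -/

section Descent

variable {E : Type*} [NormedAddCommGroup E] [InnerProductSpace ℝ E] [CompleteSpace E] {L : E → ℝ}

theorem hasDerivAt_along_line (hL : Differentiable ℝ L) (w z : E) (s : ℝ) :
    HasDerivAt (fun s : ℝ => L (w + s • z)) ⟪gradient L (w + s • z), z⟫_ℝ s := by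
  have hline : HasDerivAt (fun s : ℝ => w + s • z) z s := by
    simpa using ((hasDerivAt_id s).smul_const z).const_add w
  exact (hL (w + s • z)).hasGradientAt.hasFDerivAt.comp_hasDerivAt s hline

theorem inner_gradient_along_line_le {K : NNReal} (hK : LipschitzWith K (gradient L)) (w z : E)
    {s : ℝ} (hs : 0 ≤ s) :
    ⟪gradient L (w + s • z), z⟫_ℝ ≤ ⟪gradient L w, z⟫_ℝ + K * s * ‖z‖ ^ 2 := by
  have hnorm : ‖gradient L (w + s • z) - gradient L w‖ ≤ K * (s * ‖z‖) := by
    simpa [dist_eq_norm, norm_smul, abs_of_nonneg hs] using hK.dist_le_mul (w + s • z) w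
  calc ⟪gradient L (w + s • z), z⟫_ℝ
      = ⟪gradient L w, z⟫_ℝ + ⟪gradient L (w + s • z) - gradient L w, z⟫_ℝ := by
        rw [inner_sub_left]; ring
    _ ≤ ⟪gradient L w, z⟫_ℝ + K * (s * ‖z‖) * ‖z‖ := by
        gcongr
        exact (real_inner_le_norm _ _).trans (by gcongr)
    _ = _ := by ring

theorem le_add_inner_gradient_of_lipschitzWith (hL : Differentiable ℝ L) {K : NNReal}
    (hK : LipschitzWith K (gradient L)) (w z : E) :
    L (w + z) ≤ L w + ⟪gradient L w, z⟫_ℝ + K / 2 * ‖z‖ ^ 2 := by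
  have hbound (s : ℝ) :
      HasDerivAt (fun s : ℝ => L w + s * ⟪gradient L w, z⟫_ℝ + s ^ 2 * (K / 2 * ‖z‖ ^ 2))
        (⟪gradient L w, z⟫_ℝ + K * s * ‖z‖ ^ 2) s := by
    refine ((((hasDerivAt_id s).mul_const ⟪gradient L w, z⟫_ℝ).const_add (L w)).add
      (((hasDerivAt_id s).pow 2).mul_const (K / 2 * ‖z‖ ^ 2))).congr_deriv ?_
    simp only [id]
    ring
  have hline := hasDerivAt_along_line hL w z
  have hle := image_le_of_deriv_right_le_deriv_boundary (a := 0) (b := 1)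
    (fun s _ => (hline s).continuousAt.continuousWithinAt)
    (fun s _ => (hline s).hasDerivWithinAt) (by simp)
    (fun s _ => (hbound s).continuousAt.continuousWithinAt)
    (fun s _ => (hbound s).hasDerivWithinAt)
    (fun s hs => inner_gradient_along_line_le hK w z hs.1) (Set.right_mem_Icc.2 zero_le_one)
  simpa using hle

theorem gradient_step_le_of_lipschitzWith (hL : Differentiable ℝ L) {K : NNReal}
    (hK : LipschitzWith K (gradient L)) (η : ℝ) (w : E) :
    L (w - η • gradient L w) ≤ L w - η * (1 - η * K / 2) * ‖gradient L w‖ ^ 2 := by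
  have hle := le_add_inner_gradient_of_lipschitzWith hL hK w (-(η • gradient L w))
  rw [← sub_eq_add_neg, inner_neg_right, inner_smul_right, real_inner_self_eq_norm_sq, norm_neg,
    norm_smul, mul_pow, Real.norm_eq_abs, sq_abs] at hle
  linarith

theorem tendsto_gradient_gdIter (hL : Differentiable ℝ L) (hbdd : BddBelow (Set.range L)) {η : ℝ}
    (hη : AdmissibleStep L η) (w₀ : E) :
    Tendsto (fun t => gradient L (gdIter L η w₀ t)) atTop (𝓝 0) := by
  obtain ⟨hη0, K, hK, hηK⟩ := hη
  obtain ⟨B, hB⟩ := hbdd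
  set w := gdIter L η w₀
  have hc : 0 < η * (1 - η * K / 2) := mul_pos hη0 (by linarith)
  have hstep (t : ℕ) : η * (1 - η * K / 2) * ‖gradient L (w t)‖ ^ 2 ≤ L (w t) - L (w (t + 1)) :=
    le_sub_comm.1 (gradient_step_le_of_lipschitzWith hL hK η (w t))
  have hsum : Summable fun t => η * (1 - η * K / 2) * ‖gradient L (w t)‖ ^ 2 := by
    refine summable_of_sum_range_le (c := L (w 0) - B) (fun t => by positivity) fun T => ?_
    refine (Finset.sum_le_sum fun t _ => hstep t).trans ?_
    rw [Finset.sum_range_sub']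
    linarith [hB ⟨w T, rfl⟩]
  have hsq := ((summable_mul_left_iff hc.ne').1 hsum).tendsto_atTop_zero
  rw [tendsto_zero_iff_norm_tendsto_zero]
  simpa using hsq.sqrt

theorem exists_admissibleStep_of_lipschitzWith {K : NNReal} (hK : LipschitzWith K (gradient L)) :
    ∃ η, AdmissibleStep L η := by
  refine ⟨(K + 1 : ℝ)⁻¹, by positivity, K, hK, ?_⟩
  rw [inv_mul_lt_iff₀ (by positivity)]
  linarith [K.coe_nonneg]

theorem norm_gdIter_succ_sub {η : ℝ} (hη : 0 ≤ η) (w₀ : E) (t : ℕ) :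
    ‖gdIter L η w₀ (t + 1) - gdIter L η w₀ t‖ = η * ‖gradient L (gdIter L η w₀ t)‖ := by
  rw [gdIter, sub_sub_cancel_left, norm_neg, norm_smul, Real.norm_of_nonneg hη]

end Descent

/-! ### Minimum-norm points -/

section MinNorm

theorem isMinNorm_iff_norm_eq_iInf {E : Type*} [NormedAddCommGroup E] {S : Set E} {w : E} :
    IsMinNorm S w ↔ w ∈ S ∧ ‖0 - w‖ = ⨅ v : S, ‖0 - (v : E)‖ := by
  refine and_congr_right fun hw => ?_
  have : Nonempty S := ⟨⟨w, hw⟩⟩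
  have hbdd : BddBelow (Set.range fun v : S => ‖(v : E)‖) :=
    ⟨0, by rintro _ ⟨v, rfl⟩; exact norm_nonneg _⟩
  simp only [zero_sub, norm_neg, sq_le_sq₀ (norm_nonneg _) (norm_nonneg _)]
  exact ⟨fun h => le_antisymm (le_ciInf fun v => h v v.2) (ciInf_le hbdd ⟨w, hw⟩),
    fun h v hv => h ▸ ciInf_le hbdd ⟨v, hv⟩⟩

variable {E : Type*} [NormedAddCommGroup E] [InnerProductSpace ℝ E] {S : Set E} {v w : E}

theorem exists_isMinNorm [CompleteSpace E] (hne : S.Nonempty) (hclosed : IsClosed S)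
    (hconv : Convex ℝ S) : ∃ w, IsMinNorm S w := by
  simpa only [isMinNorm_iff_norm_eq_iInf] using
    exists_norm_eq_iInf_of_complete_convex hne hclosed.isComplete hconv 0

theorem IsMinNorm.norm_sq_le_inner (hw : IsMinNorm S w) (hS : Convex ℝ S) (hv : v ∈ S) :
    ‖w‖ ^ 2 ≤ ⟪w, v⟫_ℝ := by
  have hproj := (norm_eq_iInf_iff_real_inner_le_zero hS hw.1).1
    (isMinNorm_iff_norm_eq_iInf.1 hw).2 v hv
  rw [zero_sub, inner_neg_left, inner_sub_right, real_inner_self_eq_norm_sq] at hproj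
  linarith

theorem IsMinNorm.iff_eq (hw : IsMinNorm S w) (hS : Convex ℝ S) (v : E) :
    IsMinNorm S v ↔ v = w := by
  refine ⟨fun hv => ?_, fun h => h ▸ hw⟩
  have hsq : ‖v - w‖ ^ 2 ≤ 0 := by
    linarith [norm_sub_sq_real v w, hv.norm_sq_le_inner hS hw.1, hw.2 v hv.1]
  exact sub_eq_zero.1 (norm_eq_zero.1 (pow_eq_zero_iff two_ne_zero |>.1
    (le_antisymm hsq (sq_nonneg _))))

section Preimage

variable {F : Type*} [NormedAddCommGroup F] [InnerProductSpace ℝ F] [CompleteSpace E]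
  [CompleteSpace F] {A : E →L[ℝ] F} {c : ℝ}

theorem norm_sq_apply_le_of_comp_adjoint_eq_smul (hc : 0 < c) (hA : ∀ u, A (A.adjoint u) = c • u)
    (w : E) : ‖A w‖ ^ 2 ≤ c * ‖w‖ ^ 2 := by
  have hcross : ⟪w, A.adjoint (A w)⟫_ℝ = ‖A w‖ ^ 2 := by
    rw [ContinuousLinearMap.adjoint_inner_right, real_inner_self_eq_norm_sq]
  have hadjoint : ‖A.adjoint (A w)‖ ^ 2 = c * ‖A w‖ ^ 2 := by
    rw [← real_inner_self_eq_norm_sq, ContinuousLinearMap.adjoint_inner_left, hA,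
      inner_smul_right, real_inner_self_eq_norm_sq]
  have hsub := norm_sub_sq_real w (c⁻¹ • A.adjoint (A w))
  rw [inner_smul_right, hcross, norm_smul, mul_pow, hadjoint, Real.norm_eq_abs, sq_abs] at hsub
  have hnonneg : 0 ≤ ‖w‖ ^ 2 - c⁻¹ * ‖A w‖ ^ 2 := by
    refine (sq_nonneg ‖w - c⁻¹ • A.adjoint (A w)‖).trans_eq (hsub.trans ?_)
    field_simp
    ring
  rwa [sub_nonneg, inv_mul_le_iff₀ hc] at hnonneg

theorem IsMinNorm.preimage {S : Set F} {u : F} (hu : IsMinNorm S u) (hc : 0 < c)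
    (hA : ∀ u, A (A.adjoint u) = c • u) : IsMinNorm (A ⁻¹' S) (c⁻¹ • A.adjoint u) := by
  have himage : A (c⁻¹ • A.adjoint u) = u := by rw [map_smul, hA, inv_smul_smul₀ hc.ne']
  refine ⟨(congrArg (· ∈ S) himage).mpr hu.1, fun w hw => ?_⟩
  have hnorm : c * ‖c⁻¹ • A.adjoint u‖ ^ 2 = ‖u‖ ^ 2 := by
    rw [← real_inner_self_eq_norm_sq, real_inner_smul_left, ContinuousLinearMap.adjoint_inner_left,
      himage, mul_inv_cancel_left₀ hc.ne', real_inner_self_eq_norm_sq]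
  refine le_of_mul_le_mul_left ?_ hc
  calc c * ‖c⁻¹ • A.adjoint u‖ ^ 2 = ‖u‖ ^ 2 := hnorm
    _ ≤ ‖A w‖ ^ 2 := hu.2 _ hw
    _ ≤ c * ‖w‖ ^ 2 := norm_sq_apply_le_of_comp_adjoint_eq_smul hc hA w

end Preimage

end MinNorm

/-! ### Margins -/

section Margin

variable {E : Type*} [NormedAddCommGroup E] [InnerProductSpace ℝ E] {κ : Type*} {x : κ → E}
  {v w : E}

/-- The vectors of margin at least one against every `x i`: the feasible set of the hard-margin
support vector machine whose features `x i` already carry the sign of their labels. -/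
def marginSet (x : κ → E) : Set E := {w | ∀ i, 1 ≤ ⟪w, x i⟫_ℝ}

theorem convex_marginSet (x : κ → E) : Convex ℝ (marginSet x) := by
  intro v hv w hw a b ha hb hab i
  rw [inner_add_left, real_inner_smul_left, real_inner_smul_left]
  nlinarith [hv i, hw i]

theorem isClosed_marginSet (x : κ → E) : IsClosed (marginSet x) := by
  simp only [marginSet, Set.ofPred_forall]
  exact isClosed_iInter fun i => isClosed_le continuous_const (by fun_prop)

theorem preimage_marginSet {F : Type*} [NormedAddCommGroup F] [InnerProductSpace ℝ F]
    [CompleteSpace E] [CompleteSpace F] (A : F →L[ℝ] E) (x : κ → E) :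
    A ⁻¹' marginSet x = marginSet fun i => A.adjoint (x i) := by
  ext w
  simp only [marginSet, Set.mem_preimage, Set.mem_ofPred_eq,
    ContinuousLinearMap.adjoint_inner_right]

theorem inv_smul_mem_marginSet {m : ℝ} (hm : 0 < m) (hw : ∀ i, m ≤ ⟪w, x i⟫_ℝ) :
    m⁻¹ • w ∈ marginSet x := fun i => by
  rw [real_inner_smul_left, le_inv_mul_iff₀ hm, mul_one]
  exact hw i

theorem marginSet_nonempty [Finite κ] (hw : ∀ i, 0 < ⟪w, x i⟫_ℝ) : (marginSet x).Nonempty := by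
  obtain ⟨m, hm, hle⟩ : ∃ m > 0, ∀ i, m ≤ ⟪w, x i⟫_ℝ := by
    have hsmall : ∀ᶠ m in 𝓝[>] (0 : ℝ), ∀ i, m ≤ ⟪w, x i⟫_ℝ := eventually_all.2 fun i =>
      ((gt_mem_nhds (hw i)).mono fun _ => le_of_lt).filter_mono nhdsWithin_le_nhds
    exact (eventually_mem_nhdsWithin.and hsmall).exists
  exact ⟨_, inv_smul_mem_marginSet hm hle⟩

theorem exists_isMinNorm_marginSet [CompleteSpace E] [Finite κ] (hw : ∀ i, 0 < ⟪w, x i⟫_ℝ) :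
    ∃ v, IsMinNorm (marginSet x) v :=
  exists_isMinNorm (marginSet_nonempty hw) (isClosed_marginSet x) (convex_marginSet x)

theorem norm_pos_of_mem_marginSet [Nonempty κ] (hv : v ∈ marginSet x) : 0 < ‖v‖ := by
  rw [norm_pos_iff]
  rintro rfl
  have hmargin := hv (Classical.arbitrary κ)
  rw [inner_zero_left] at hmargin
  linarith

theorem IsMinNorm.mul_norm_sq_le_inner (hv : IsMinNorm (marginSet x) v) {m : ℝ} (hm : 0 < m)
    (hw : ∀ i, m ≤ ⟪w, x i⟫_ℝ) : m * ‖v‖ ^ 2 ≤ ⟪v, w⟫_ℝ := by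
  have hle := hv.norm_sq_le_inner (convex_marginSet x) (inv_smul_mem_marginSet hm hw)
  rwa [inner_smul_right, le_inv_mul_iff₀ hm] at hle

theorem IsMinNorm.norm_sub_direction_sq_le [Nonempty κ] (hv : IsMinNorm (marginSet x) v) {m : ℝ}
    (hm : 0 < m) (hmargin : ∀ i, m ≤ ⟪w, x i⟫_ℝ) (hw : ‖w‖ ≤ 1) :
    ‖w - ‖v‖⁻¹ • v‖ ^ 2 ≤ 2 * (1 - m * ‖v‖) := by
  have hpos := norm_pos_of_mem_marginSet hv.1
  have hinner : m * ‖v‖ ≤ ⟪w, ‖v‖⁻¹ • v⟫_ℝ := by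
    rw [inner_smul_right, real_inner_comm, le_inv_mul_iff₀ hpos]
    calc ‖v‖ * (m * ‖v‖) = m * ‖v‖ ^ 2 := by ring
      _ ≤ ⟪v, w⟫_ℝ := hv.mul_norm_sq_le_inner hm hmargin
  have hunit : ‖‖v‖⁻¹ • v‖ = 1 := by
    rw [norm_smul, norm_inv, norm_norm, inv_mul_cancel₀ hpos.ne']
  have hsq : ‖w‖ ^ 2 ≤ 1 := pow_le_one₀ (norm_nonneg w) hw
  rw [norm_sub_sq_real, hunit]
  linarith

theorem IsMinNorm.tendsto_direction [Nonempty κ] (hv : IsMinNorm (marginSet x) v) {α : Type*}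
    {l : Filter α} {u : α → E} (hu : ∀ᶠ t in l, ‖u t‖ ≤ 1)
    (hmargin : ∀ m < ‖v‖⁻¹, ∀ᶠ t in l, ∀ i, m ≤ ⟪u t, x i⟫_ℝ) :
    Tendsto u l (𝓝 (‖v‖⁻¹ • v)) := by
  have hpos := norm_pos_of_mem_marginSet hv.1
  rw [Metric.tendsto_nhds]
  intro ε hε
  obtain ⟨m, hm, hm_lt⟩ : ∃ m, max 0 (‖v‖⁻¹ * (1 - ε ^ 2 / 2)) < m ∧ m < ‖v‖⁻¹ := by
    refine exists_between (max_lt (inv_pos.2 hpos) (mul_lt_of_lt_one_right (inv_pos.2 hpos) ?_))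
    linarith [pow_pos hε 2]
  obtain ⟨hm_pos, hm_near⟩ := max_lt_iff.1 hm
  rw [inv_mul_lt_iff₀' hpos] at hm_near
  filter_upwards [hu, hmargin m hm_lt] with t ht hmt
  have hsq := hv.norm_sub_direction_sq_le hm_pos hmt ht
  rw [dist_eq_norm]
  exact lt_of_pow_lt_pow_left₀ 2 hε.le (by linarith)

end Margin

/-! ### Weighted logistic losses -/

section LogitLoss

variable {E : Type*} [NormedAddCommGroup E] [InnerProductSpace ℝ E] {κ : Type*} [Fintype κ]

/-- The logistic loss, with weights `a` and offsets `b`, of the linear model whose features `x i`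
already carry the sign of their labels. -/
noncomputable def logitLoss (a b : κ → ℝ) (x : κ → E) (w : E) : ℝ :=
  ∑ i, a i * softplus (b i - ⟪w, x i⟫_ℝ)

/-- The total weight of the features in the gradient of `logitLoss`, comparable both to the loss
and to the norm of its gradient. -/
noncomputable def logitWeight (a b : κ → ℝ) (x : κ → E) (w : E) : ℝ :=
  ∑ i, a i * Real.sigmoid (b i - ⟪w, x i⟫_ℝ)

variable {a b : κ → ℝ} {x : κ → E} {v w z : E} {M η : ℝ}

theorem logitLoss_pos [Nonempty κ] (ha : ∀ i, 0 < a i) (w : E) : 0 < logitLoss a b x w :=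
  Finset.sum_pos (fun i _ => mul_pos (ha i) (softplus_pos _)) Finset.univ_nonempty

theorem logitLoss_nonneg (ha : ∀ i, 0 ≤ a i) (w : E) : 0 ≤ logitLoss a b x w :=
  Finset.sum_nonneg fun i _ => mul_nonneg (ha i) (softplus_pos _).le

theorem bddBelow_range_logitLoss (ha : ∀ i, 0 ≤ a i) :
    BddBelow (Set.range (logitLoss a b x)) :=
  ⟨0, Set.forall_mem_range.2 (logitLoss_nonneg ha)⟩

theorem mul_softplus_le_logitLoss (ha : ∀ i, 0 ≤ a i) (w : E) (i : κ) :
    a i * softplus (b i - ⟪w, x i⟫_ℝ) ≤ logitLoss a b x w :=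
  Finset.single_le_sum (f := fun i => a i * softplus (b i - ⟪w, x i⟫_ℝ))
    (fun j _ => mul_nonneg (ha j) (softplus_pos _).le) (Finset.mem_univ i)

theorem mul_sigmoid_le_logitWeight (ha : ∀ i, 0 ≤ a i) (w : E) (i : κ) :
    a i * Real.sigmoid (b i - ⟪w, x i⟫_ℝ) ≤ logitWeight a b x w :=
  Finset.single_le_sum (f := fun i => a i * Real.sigmoid (b i - ⟪w, x i⟫_ℝ))
    (fun j _ => mul_nonneg (ha j) (Real.sigmoid_nonneg _)) (Finset.mem_univ i)

theorem sub_log_logitLoss_le_inner [Nonempty κ] (ha : ∀ i, 0 < a i) {i : κ}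
    (h : logitLoss a b x w ≤ a i) :
    b i + Real.log (a i) - Real.log 2 - Real.log (logitLoss a b x w) ≤ ⟪w, x i⟫_ℝ := by
  have hL : 0 < logitLoss a b x w := logitLoss_pos ha w
  have hsoftplus : softplus (b i - ⟪w, x i⟫_ℝ) ≤ logitLoss a b x w / a i := by
    rw [le_div_iff₀' (ha i)]
    exact mul_softplus_le_logitLoss (fun j => (ha j).le) w i
  have hexp : Real.exp (b i - ⟪w, x i⟫_ℝ) ≤ 2 * (logitLoss a b x w / a i) :=
    (exp_le_two_mul_softplus (hsoftplus.trans ((div_le_one (ha i)).2 h))).trans (by gcongr)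
  have hlog := (Real.le_log_iff_exp_le (mul_pos two_pos (div_pos hL (ha i)))).2 hexp
  rw [Real.log_mul two_ne_zero (div_pos hL (ha i)).ne', Real.log_div hL.ne' (ha i).ne'] at hlog
  linarith

theorem logitLoss_le_sum_mul_exp (ha : ∀ i, 0 ≤ a i) {m : ℝ} (hm : ∀ i, m ≤ ⟪w, x i⟫_ℝ) :
    logitLoss a b x w ≤ (∑ i, a i * Real.exp (b i)) * Real.exp (-m) := by
  rw [logitLoss, Finset.sum_mul]
  refine Finset.sum_le_sum fun i _ => ?_
  rw [mul_assoc, ← Real.exp_add, ← sub_eq_add_neg]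
  refine mul_le_mul_of_nonneg_left ((softplus_le_exp _).trans ?_) (ha i)
  gcongr
  exact hm i

theorem log_logitLoss_le [Nonempty κ] (ha : ∀ i, 0 < a i) {m : ℝ} (hm : ∀ i, m ≤ ⟪w, x i⟫_ℝ) :
    Real.log (logitLoss a b x w) ≤ Real.log (∑ i, a i * Real.exp (b i)) - m := by
  have hsum : 0 < ∑ i, a i * Real.exp (b i) :=
    Finset.sum_pos (fun i _ => mul_pos (ha i) (Real.exp_pos _)) Finset.univ_nonempty
  refine (Real.log_le_log (logitLoss_pos ha w)
    (logitLoss_le_sum_mul_exp (fun i => (ha i).le) hm)).trans_eq ?_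
  rw [Real.log_mul hsum.ne' (Real.exp_ne_zero _), Real.log_exp, sub_eq_add_neg]

theorem logitLoss_le_mul_logitWeight (ha : ∀ i, 0 ≤ a i) {ε : ℝ}
    (hε : ∀ i, Real.exp (b i - ⟪w, x i⟫_ℝ) ≤ ε) :
    logitLoss a b x w ≤ (1 + ε) * logitWeight a b x w := by
  rw [logitLoss, logitWeight, Finset.mul_sum]
  refine Finset.sum_le_sum fun i _ => ?_
  rw [mul_left_comm]
  exact mul_le_mul_of_nonneg_left (softplus_le_mul_sigmoid (hε i)) (ha i)

theorem logitLoss_comp {F : Type*} [NormedAddCommGroup F] [InnerProductSpace ℝ F]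
    [CompleteSpace E] [CompleteSpace F] (a b : κ → ℝ) (x : κ → E) (A : F →L[ℝ] E) :
    logitLoss a b x ∘ A = logitLoss a b fun i => A.adjoint (x i) := by
  ext w
  simp only [logitLoss, Function.comp_apply, ContinuousLinearMap.adjoint_inner_right]

variable [CompleteSpace E]

theorem hasGradientAt_logitLoss (a b : κ → ℝ) (x : κ → E) (w : E) :
    HasGradientAt (logitLoss a b x) (-∑ i, (a i * Real.sigmoid (b i - ⟪w, x i⟫_ℝ)) • x i) w := by
  have hlinear (i : κ) : HasFDerivAt (fun w : E => b i - ⟪w, x i⟫_ℝ) (-innerSL ℝ (x i)) w := by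
    simpa only [innerSL_apply_apply, real_inner_comm] using
      ((innerSL ℝ (x i)).hasFDerivAt (x := w)).const_sub (b i)
  have hterm (i : κ) : HasFDerivAt (fun w => a i * softplus (b i - ⟪w, x i⟫_ℝ))
      (a i • Real.sigmoid (b i - ⟪w, x i⟫_ℝ) • -innerSL ℝ (x i)) w :=
    ((hasDerivAt_softplus _).comp_hasFDerivAt w (hlinear i)).const_mul (a i)
  rw [hasGradientAt_iff_hasFDerivAt]
  refine (HasFDerivAt.fun_sum fun i _ => hterm i).congr_fderiv ?_
  ext v
  simp [mul_assoc]

theorem gradient_logitLoss (a b : κ → ℝ) (x : κ → E) (w : E) :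
    gradient (logitLoss a b x) w = -∑ i, (a i * Real.sigmoid (b i - ⟪w, x i⟫_ℝ)) • x i :=
  (hasGradientAt_logitLoss a b x w).gradient

theorem differentiable_logitLoss (a b : κ → ℝ) (x : κ → E) : Differentiable ℝ (logitLoss a b x) :=
  fun w => (hasGradientAt_logitLoss a b x w).differentiableAt

theorem inner_gradient_logitLoss (a b : κ → ℝ) (x : κ → E) (w z : E) :
    ⟪gradient (logitLoss a b x) w, z⟫_ℝ =
      -∑ i, a i * Real.sigmoid (b i - ⟪w, x i⟫_ℝ) * ⟪z, x i⟫_ℝ := by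
  rw [real_inner_comm, gradient_logitLoss, inner_neg_right, inner_sum]
  simp only [inner_smul_right]

theorem lipschitzWith_gradient_logitLoss (a b : κ → ℝ) (x : κ → E) :
    LipschitzWith (∑ i, ‖a i‖₊ * ‖x i‖₊ ^ 2) (gradient (logitLoss a b x)) := by
  have hsigmoid (v w : E) (i : κ) :
      ‖Real.sigmoid (b i - ⟪w, x i⟫_ℝ) - Real.sigmoid (b i - ⟪v, x i⟫_ℝ)‖ ≤ ‖v - w‖ * ‖x i‖ := by
    refine (lipschitzWith_sigmoid.norm_sub_le _ _).trans ?_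
    rw [NNReal.coe_one, one_mul, sub_sub_sub_cancel_left, ← inner_sub_left]
    exact norm_inner_le_norm _ _
  refine LipschitzWith.of_dist_le_mul fun v w => ?_
  rw [dist_eq_norm, dist_eq_norm, gradient_logitLoss, gradient_logitLoss, neg_sub_neg,
    ← Finset.sum_sub_distrib, NNReal.coe_sum, Finset.sum_mul]
  refine norm_sum_le_of_le _ fun i _ => ?_
  rw [← sub_smul, ← mul_sub, norm_smul, norm_mul]
  calc ‖a i‖ * ‖Real.sigmoid (b i - ⟪w, x i⟫_ℝ) - Real.sigmoid (b i - ⟪v, x i⟫_ℝ)‖ * ‖x i‖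
      ≤ ‖a i‖ * (‖v - w‖ * ‖x i‖) * ‖x i‖ := by
        gcongr
        exact hsigmoid v w i
    _ = ↑(‖a i‖₊ * ‖x i‖₊ ^ 2) * ‖v - w‖ := by push_cast; ring

/-- Pairing the gradient with a vector of unit margins recovers at least the total weight. -/
theorem logitWeight_le_norm_gradient (ha : ∀ i, 0 ≤ a i) (hv : v ∈ marginSet x) (w : E) :
    logitWeight a b x w ≤ ‖v‖ * ‖gradient (logitLoss a b x) w‖ := by
  calc logitWeight a b x w
      ≤ ∑ i, a i * Real.sigmoid (b i - ⟪w, x i⟫_ℝ) * ⟪v, x i⟫_ℝ :=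
        Finset.sum_le_sum fun i _ =>
          le_mul_of_one_le_right (mul_nonneg (ha i) (Real.sigmoid_nonneg _)) (hv i)
    _ = ⟪v, -gradient (logitLoss a b x) w⟫_ℝ := by
        rw [inner_neg_right, real_inner_comm, inner_gradient_logitLoss, neg_neg]
    _ ≤ ‖v‖ * ‖gradient (logitLoss a b x) w‖ := by
        rw [← norm_neg (gradient _ _)]
        exact real_inner_le_norm _ _

theorem norm_gradient_logitLoss_le (ha : ∀ i, 0 ≤ a i) (hx : ∀ i, ‖x i‖ ≤ M) (w : E) :
    ‖gradient (logitLoss a b x) w‖ ≤ M * logitWeight a b x w := by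
  rw [gradient_logitLoss, norm_neg, logitWeight, Finset.mul_sum]
  refine norm_sum_le_of_le _ fun i _ => ?_
  have hnonneg := mul_nonneg (ha i) (Real.sigmoid_nonneg (b i - ⟪w, x i⟫_ℝ))
  rw [norm_smul, Real.norm_of_nonneg hnonneg, mul_comm]
  exact mul_le_mul_of_nonneg_right (hx i) hnonneg

theorem logitLoss_add_le (ha : ∀ i, 0 ≤ a i) (hx : ∀ i, ‖x i‖ ≤ M) (hz : M * ‖z‖ ≤ 1) (w : E) :
    logitLoss a b x (w + z) ≤ logitLoss a b x w + ⟪gradient (logitLoss a b x) w, z⟫_ℝ +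
      (M * ‖z‖) ^ 2 * logitWeight a b x w := by
  rw [inner_gradient_logitLoss, logitLoss, logitLoss, logitWeight, ← Finset.sum_neg_distrib,
    Finset.mul_sum, ← Finset.sum_add_distrib, ← Finset.sum_add_distrib]
  refine Finset.sum_le_sum fun i _ => ?_
  set s := b i - ⟪w, x i⟫_ℝ
  set r := ⟪z, x i⟫_ℝ
  have hr : |-r| ≤ M * ‖z‖ := by
    rw [abs_neg, mul_comm]
    exact (abs_real_inner_le_norm z (x i)).trans (by gcongr; exact hx i)
  have hr_sq : (-r) ^ 2 ≤ (M * ‖z‖) ^ 2 := sq_le_sq' (abs_le.1 hr).1 (abs_le.1 hr).2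
  have hs : b i - ⟪w + z, x i⟫_ℝ = s + -r := by rw [inner_add_left]; ring
  calc a i * softplus (b i - ⟪w + z, x i⟫_ℝ)
      ≤ a i * (softplus s + Real.sigmoid s * (-r + (-r) ^ 2)) := by
        rw [hs]
        exact mul_le_mul_of_nonneg_left (softplus_add_le_of_abs_le_one s (hr.trans hz)) (ha i)
    _ ≤ a i * (softplus s + Real.sigmoid s * (-r + (M * ‖z‖) ^ 2)) := by
        have hsigmoid := Real.sigmoid_nonneg s
        have hai := ha i
        gcongr
    _ = a i * softplus s + -(a i * Real.sigmoid s * r) +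
          (M * ‖z‖) ^ 2 * (a i * Real.sigmoid s) := by ring

/-- The curvature of the loss is bounded by its weight, so the admissible step sizes grow without
bound as the loss vanishes. -/
theorem logitLoss_gradient_step_le (ha : ∀ i, 0 ≤ a i) (hM : 0 ≤ M) (hx : ∀ i, ‖x i‖ ≤ M)
    (hη : 0 ≤ η) (hstep : η * (M ^ 2 * logitWeight a b x w) ≤ 1) :
    logitLoss a b x (w - η • gradient (logitLoss a b x) w) ≤ logitLoss a b x w -
      η * (1 - η * (M ^ 2 * logitWeight a b x w)) * ‖gradient (logitLoss a b x) w‖ ^ 2 := by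
  set g := gradient (logitLoss a b x) w
  have hnorm : ‖-(η • g)‖ = η * ‖g‖ := by rw [norm_neg, norm_smul, Real.norm_of_nonneg hη]
  have hsmall : M * ‖-(η • g)‖ ≤ 1 := by
    calc M * ‖-(η • g)‖ = η * (M * ‖g‖) := by rw [hnorm]; ring
      _ ≤ η * (M * (M * logitWeight a b x w)) := by
        gcongr
        exact norm_gradient_logitLoss_le ha hx w
      _ ≤ 1 := by linarith
  rw [sub_eq_add_neg w]
  refine (logitLoss_add_le ha hx hsmall w).trans_eq ?_
  rw [hnorm, inner_neg_right, inner_smul_right, real_inner_self_eq_norm_sq]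
  ring

end LogitLoss

/-! ### Convergence in direction on separable data -/

section Direction

variable {E : Type*} [NormedAddCommGroup E]

theorem tendsto_const_sub_atBot {α : Type*} {l : Filter α} {f : α → ℝ} (c : ℝ)
    (hf : Tendsto f l atTop) : Tendsto (fun t => c - f t) l atBot := by
  simpa only [sub_eq_add_neg, Function.comp_apply] using
    tendsto_atBot_add_const_left l c (tendsto_neg_atTop_atBot.comp hf)

theorem exists_eventually_le_sub_mul_norm {φ : ℕ → ℝ} {w : ℕ → E} {m : ℝ} (hm : 0 ≤ m)
    (h : ∀ᶠ t in atTop, φ (t + 1) ≤ φ t - m * ‖w (t + 1) - w t‖) :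
    ∃ C, ∀ᶠ t in atTop, φ t ≤ C - m * ‖w t‖ := by
  obtain ⟨t₀, ht₀⟩ := eventually_atTop.1 h
  refine ⟨φ t₀ + m * ‖w t₀‖, eventually_atTop.2 ⟨t₀, fun t ht => ?_⟩⟩
  induction t, ht using Nat.le_induction with
  | base => linarith
  | succ t ht ih =>
    have hnorm : m * ‖w (t + 1)‖ ≤ m * (‖w (t + 1) - w t‖ + ‖w t‖) :=
      mul_le_mul_of_nonneg_left (by simpa using norm_add_le (w (t + 1) - w t) (w t)) hm
    linarith [ht₀ t ht]

theorem exists_isBallMin [ProperSpace E] {L : E → ℝ} (hL : Continuous L) {R : ℝ} (hR : 0 ≤ R) :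
    ∃ w, IsBallMin L R w :=
  (isCompact_closedBall (0 : E) R).exists_isMinOn ⟨0, Metric.mem_closedBall_self hR⟩ hL.continuousOn

variable [InnerProductSpace ℝ E]

theorem IsTrained.unique [CompleteSpace E] {L : E → ℝ} {v w : E} (hv : IsTrained L v)
    (hw : IsTrained L w) : v = w := by
  obtain ⟨η, hη⟩ := hv.1.1
  exact tendsto_nhds_unique (hv.1.2 η 0 hη).2.2 (hw.1.2 η 0 hη).2.2

theorem tendsto_norm_atTop_of_tendsto_inner {α : Type*} {l : Filter α} {w : α → E} {z : E}
    (h : Tendsto (fun t => ⟪w t, z⟫_ℝ) l atTop) : Tendsto (fun t => ‖w t‖) l atTop := by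
  have hmul : Tendsto (fun t => ‖w t‖ * (‖z‖ + 1)) l atTop :=
    tendsto_atTop_mono (fun t => (real_inner_le_norm _ _).trans (by gcongr; linarith)) h
  exact (tendsto_mul_const_atTop_of_pos (by positivity)).1 hmul

variable {κ : Type*} [Fintype κ] {a b : κ → ℝ} {x : κ → E} {v : E} {α : Type*} {l : Filter α}
  {w : α → E}

theorem tendsto_logitLoss_zero (hw : ∀ i, Tendsto (fun t => ⟪w t, x i⟫_ℝ) l atTop) :
    Tendsto (fun t => logitLoss a b x (w t)) l (𝓝 0) := by
  simpa [logitLoss] using tendsto_finsetSum Finset.univ fun i _ =>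
    (tendsto_softplus_atBot.comp (tendsto_const_sub_atBot (b i) (hw i))).const_mul
      (a i)

theorem tendsto_logitWeight_zero (hw : ∀ i, Tendsto (fun t => ⟪w t, x i⟫_ℝ) l atTop) :
    Tendsto (fun t => logitWeight a b x (w t)) l (𝓝 0) := by
  simpa [logitWeight] using tendsto_finsetSum Finset.univ fun i _ =>
    (Real.tendsto_sigmoid_atBot.comp
      (tendsto_const_sub_atBot (b i) (hw i))).const_mul (a i)

theorem eventually_mul_le_inner_of_log_logitLoss_le [Nonempty κ] (ha : ∀ i, 0 < a i) {r : α → ℝ}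
    (hr : Tendsto r l atTop) {m m' C : ℝ} (hm' : 0 < m') (hmm' : m < m')
    (hlog : ∀ᶠ t in l, Real.log (logitLoss a b x (w t)) ≤ C - m' * r t) :
    ∀ᶠ t in l, ∀ i, m * r t ≤ ⟪w t, x i⟫_ℝ := by
  refine eventually_all.2 fun i => ?_
  filter_upwards [hlog, (hr.const_mul_atTop hm').eventually_ge_atTop (C - Real.log (a i)),
    (hr.const_mul_atTop (sub_pos.2 hmm')).eventually_ge_atTop
      (C + Real.log 2 - b i - Real.log (a i))] with t ht hloss hmargin
  have hle : logitLoss a b x (w t) ≤ a i :=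
    (Real.log_le_log_iff (logitLoss_pos ha _) (ha i)).1 (by linarith)
  linarith [sub_log_logitLoss_le_inner ha hle]

theorem IsMinNorm.tendsto_direction_of_log_logitLoss_le [Nonempty κ]
    (hv : IsMinNorm (marginSet x) v) (ha : ∀ i, 0 < a i) {r : α → ℝ} (hr : Tendsto r l atTop)
    (hw : ∀ᶠ t in l, ‖w t‖ ≤ r t) (hlog : ∀ m, 0 ≤ m → m < ‖v‖⁻¹ →
      ∃ C, ∀ᶠ t in l, Real.log (logitLoss a b x (w t)) ≤ C - m * r t) :
    Tendsto (fun t => (r t)⁻¹ • w t) l (𝓝 (‖v‖⁻¹ • v)) := by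
  refine hv.tendsto_direction ?_ fun m hm => ?_
  · filter_upwards [hw, hr.eventually_gt_atTop 0] with t ht hrt
    rwa [norm_smul, norm_inv, Real.norm_of_nonneg hrt.le, inv_mul_le_iff₀ hrt, mul_one]
  obtain ⟨m', hlt, hm'⟩ :=
    exists_between (max_lt (inv_pos.2 (norm_pos_of_mem_marginSet hv.1)) hm)
  obtain ⟨hm'_pos, hmm'⟩ := max_lt_iff.1 hlt
  obtain ⟨C, hC⟩ := hlog m' hm'_pos.le hm'
  filter_upwards [eventually_mul_le_inner_of_log_logitLoss_le ha hr hm'_pos hmm' hC,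
    hr.eventually_gt_atTop 0] with t ht hrt i
  rw [real_inner_smul_left, le_inv_mul_iff₀ hrt, mul_comm]
  exact ht i

theorem isPathDirection_logitLoss [Nonempty κ] [ProperSpace E] (hv : IsMinNorm (marginSet x) v)
    (ha : ∀ i, 0 < a i) : IsPathDirection (logitLoss a b x) (‖v‖⁻¹ • v) := by
  have hpos := norm_pos_of_mem_marginSet hv.1
  refine ⟨fun R hR => exists_isBallMin (differentiable_logitLoss a b x).continuous hR.le,
    fun w hw => ?_⟩
  refine hv.tendsto_direction_of_log_logitLoss_le (b := b) ha tendsto_id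
    ((eventually_gt_atTop 0).mono fun R hR => mem_closedBall_zero_iff.1 (hw R hR).1)
    fun m _ hm_lt => ⟨Real.log (∑ i, a i * Real.exp (b i)), ?_⟩
  filter_upwards [eventually_gt_atTop 0] with R hR
  have hball : R • ‖v‖⁻¹ • v ∈ Metric.closedBall (0 : E) R := by
    rw [mem_closedBall_zero_iff, norm_smul, norm_smul, norm_inv, norm_norm,
      inv_mul_cancel₀ hpos.ne', mul_one, Real.norm_of_nonneg hR.le]
  have hmargin (i : κ) : m * R ≤ ⟪R • ‖v‖⁻¹ • v, x i⟫_ℝ := by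
    rw [real_inner_smul_left, real_inner_smul_left, mul_comm m]
    exact mul_le_mul_of_nonneg_left
      (hm_lt.le.trans (le_mul_of_one_le_right (inv_pos.2 hpos).le (hv.1 i))) hR.le
  calc Real.log (logitLoss a b x (w R)) ≤ Real.log (logitLoss a b x (R • ‖v‖⁻¹ • v)) :=
        Real.log_le_log (logitLoss_pos ha _) ((hw R hR).2 hball)
    _ ≤ Real.log (∑ i, a i * Real.exp (b i)) - m * R := log_logitLoss_le ha hmargin

section GradientDescent

variable [CompleteSpace E] {η : ℝ}

theorem tendsto_inner_atTop_of_tendsto_gradient (ha : ∀ i, 0 < a i) (hv : v ∈ marginSet x)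
    (hw : Tendsto (fun t => gradient (logitLoss a b x) (w t)) l (𝓝 0)) (i : κ) :
    Tendsto (fun t => ⟪w t, x i⟫_ℝ) l atTop := by
  have hsigmoid : Tendsto (fun t => Real.sigmoid (b i - ⟪w t, x i⟫_ℝ)) l (𝓝 0) := by
    have hnorm : Tendsto (fun t => (a i)⁻¹ * (‖v‖ * ‖gradient (logitLoss a b x) (w t)‖)) l (𝓝 0) :=
      by simpa using (hw.norm.const_mul ‖v‖).const_mul (a i)⁻¹
    refine squeeze_zero (fun t => Real.sigmoid_nonneg _) (fun t => ?_) hnorm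
    rw [le_inv_mul_iff₀ (ha i)]
    exact (mul_sigmoid_le_logitWeight (fun j => (ha j).le) _ i).trans
      (logitWeight_le_norm_gradient (fun j => (ha j).le) hv _)
  simpa using tendsto_atTop_add_const_left l (b i)
    (tendsto_neg_atBot_atTop.comp (tendsto_atBot_of_tendsto_sigmoid hsigmoid))

theorem eventually_logitLoss_le_norm_gradient (ha : ∀ i, 0 ≤ a i) (hv : v ∈ marginSet x)
    (hw : ∀ i, Tendsto (fun t => ⟪w t, x i⟫_ℝ) l atTop) {ε : ℝ} (hε : 0 < ε) :
    ∀ᶠ t in l, logitLoss a b x (w t) ≤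
      (1 + ε) * (‖v‖ * ‖gradient (logitLoss a b x) (w t)‖) := by
  have hexp (i : κ) : ∀ᶠ t in l, Real.exp (b i - ⟪w t, x i⟫_ℝ) ≤ ε :=
    (Real.tendsto_exp_atBot.comp
      (tendsto_const_sub_atBot (b i) (hw i))).eventually_le_const hε
  filter_upwards [eventually_all.2 hexp] with t ht
  exact (logitLoss_le_mul_logitWeight ha ht).trans
    (by gcongr; exact logitWeight_le_norm_gradient ha hv _)

theorem eventually_logitLoss_gradient_step_le (ha : ∀ i, 0 ≤ a i)
    (hw : ∀ i, Tendsto (fun t => ⟪w t, x i⟫_ℝ) l atTop) (hη : 0 ≤ η) {ε : ℝ} (hε : 0 < ε) :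
    ∀ᶠ t in l, logitLoss a b x (w t - η • gradient (logitLoss a b x) (w t)) ≤
      logitLoss a b x (w t) - η * (1 - ε) * ‖gradient (logitLoss a b x) (w t)‖ ^ 2 := by
  set M := ∑ i, ‖x i‖
  have hx (i : κ) : ‖x i‖ ≤ M :=
    Finset.single_le_sum (f := fun i => ‖x i‖) (fun _ _ => norm_nonneg _) (Finset.mem_univ i)
  have hsmall : Tendsto (fun t => η * (M ^ 2 * logitWeight a b x (w t))) l (𝓝 0) := by
    simpa using ((tendsto_logitWeight_zero hw).const_mul (M ^ 2)).const_mul η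
  filter_upwards [hsmall.eventually_le_const one_pos, hsmall.eventually_le_const hε]
    with t ht_one ht_ε
  refine (logitLoss_gradient_step_le ha (by positivity) hx hη ht_one).trans ?_
  gcongr

theorem eventually_log_logitLoss_gradient_step_le [Nonempty κ] (ha : ∀ i, 0 < a i)
    (hv : v ∈ marginSet x) (hw : ∀ i, Tendsto (fun t => ⟪w t, x i⟫_ℝ) l atTop) (hη : 0 ≤ η)
    {m : ℝ} (hm : 0 ≤ m) (hm_lt : m < ‖v‖⁻¹) :
    ∀ᶠ t in l, Real.log (logitLoss a b x (w t - η • gradient (logitLoss a b x) (w t))) ≤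
      Real.log (logitLoss a b x (w t)) - m * (η * ‖gradient (logitLoss a b x) (w t)‖) := by
  obtain ⟨ε, hε, hmε⟩ : ∃ ε > 0, m * ‖v‖ = 1 - 2 * ε := by
    refine ⟨(1 - m * ‖v‖) / 2, half_pos (sub_pos.2 ?_), by ring⟩
    rwa [← one_div, lt_div_iff₀ (norm_pos_of_mem_marginSet hv)] at hm_lt
  filter_upwards [eventually_logitLoss_le_norm_gradient (fun i => (ha i).le) hv hw hε,
    eventually_logitLoss_gradient_step_le (fun i => (ha i).le) hw hη hε] with t hloss hstep
  refine log_le_log_sub_of_le_mul (logitLoss_pos ha _) (logitLoss_pos ha _) (hstep.trans ?_)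
  set g := ‖gradient (logitLoss a b x) (w t)‖
  have hratio : m * logitLoss a b x (w t) ≤ (1 - ε) * g := by
    calc m * logitLoss a b x (w t) ≤ m * ((1 + ε) * (‖v‖ * g)) := by gcongr
      _ = (1 + ε) * (1 - 2 * ε) * g := by rw [← hmε]; ring
      _ ≤ (1 - ε) * g := by
        refine mul_le_mul_of_nonneg_right ?_ (norm_nonneg _)
        linarith [sq_nonneg ε]
  linarith [mul_le_mul_of_nonneg_left hratio (mul_nonneg hη (norm_nonneg _ : 0 ≤ g))]

theorem isGDDirection_logitLoss [Nonempty κ] (hv : IsMinNorm (marginSet x) v)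
    (ha : ∀ i, 0 < a i) : IsGDDirection (logitLoss a b x) (‖v‖⁻¹ • v) := by
  refine ⟨exists_admissibleStep_of_lipschitzWith (lipschitzWith_gradient_logitLoss a b x),
    fun η w₀ hη => ?_⟩
  have hbdd : BddBelow (Set.range (logitLoss a b x)) :=
    bddBelow_range_logitLoss fun i => (ha i).le
  have hmargin := tendsto_inner_atTop_of_tendsto_gradient ha hv.1
    (tendsto_gradient_gdIter (differentiable_logitLoss a b x) hbdd hη w₀)
  have hloss := tendsto_logitLoss_zero (a := a) (b := b) hmargin
  have hnorm := tendsto_norm_atTop_of_tendsto_inner (hmargin (Classical.arbitrary κ))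
  have hinf : ⨅ w, logitLoss a b x w = 0 :=
    le_antisymm (ge_of_tendsto' hloss fun t => ciInf_le hbdd _)
      (le_ciInf fun w => (logitLoss_pos ha w).le)
  refine ⟨hinf ▸ hloss, hnorm, hv.tendsto_direction_of_log_logitLoss_le (b := b) ha hnorm
    (Eventually.of_forall fun t => le_rfl) fun m hm hm_lt => ?_⟩
  refine exists_eventually_le_sub_mul_norm hm ?_
  filter_upwards [eventually_log_logitLoss_gradient_step_le ha hv.1 hmargin hη.1.le hm hm_lt]
    with t ht
  rwa [norm_gdIter_succ_sub hη.1.le, gdIter]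

end GradientDescent

theorem isTrained_logitLoss [Nonempty κ] [ProperSpace E] (hv : IsMinNorm (marginSet x) v)
    (ha : ∀ i, 0 < a i) : IsTrained (logitLoss a b x) (‖v‖⁻¹ • v) :=
  ⟨isGDDirection_logitLoss hv ha, isPathDirection_logitLoss hv ha⟩

theorem isTrained_logitLoss_comp [Nonempty κ] [CompleteSpace E] {F : Type*}
    [NormedAddCommGroup F] [InnerProductSpace ℝ F] [ProperSpace F] {A : F →L[ℝ] E} {u : F}
    (hu : IsMinNorm (A ⁻¹' marginSet x) u) (ha : ∀ i, 0 < a i) :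
    IsTrained (logitLoss a b x ∘ A) (‖u‖⁻¹ • u) := by
  rw [preimage_marginSet] at hu
  rw [logitLoss_comp]
  exact isTrained_logitLoss hu ha

end Direction

/-! ### The four losses -/

section Features

variable {d n : ℕ}

/-- The features of the binary VS problem, carrying the sign of their label and the temperature of
their class; `δ = 1` gives the binary CE problem. -/
noncomputable def vsFeature (δ : Fin 2 → ℝ) (h : Fin n → Feat d) (y : Fin n → Fin 2) (i : Fin n) :
    Feat d :=
  (signLabel (y i) * δ (y i)) • h i

/-- The linear map `[w₁, w₂] ↦ p w₁ - q w₂`, which sends a two-class classifier to the binary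
classifier it amounts to when its classes have temperatures `p` and `q`. -/
noncomputable def weightedDiff (p q : ℝ) : Classifier d 2 →L[ℝ] Feat d :=
  p • PiLp.proj 2 (fun _ => Feat d) 0 - q • PiLp.proj 2 (fun _ => Feat d) 1

/-- The two-class classifier `[p w, -q w]`: the adjoint of `weightedDiff p q` at `w`. -/
noncomputable def antipodalPair (p q : ℝ) (w : Feat d) : Classifier d 2 :=
  WithLp.toLp 2 ![p • w, -(q • w)]

theorem weightedDiff_apply (p q : ℝ) (W : Classifier d 2) :
    weightedDiff p q W = p • W 0 - q • W 1 := rfl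

theorem adjoint_weightedDiff (p q : ℝ) (w : Feat d) :
    (weightedDiff p q).adjoint w = antipodalPair p q w := by
  refine ext_inner_right ℝ fun W => ?_
  rw [ContinuousLinearMap.adjoint_inner_left, weightedDiff_apply, inner_sub_right,
    inner_smul_right, inner_smul_right, PiLp.inner_apply (antipodalPair p q w), Fin.sum_univ_two]
  simp only [antipodalPair, Matrix.cons_val_zero, Matrix.cons_val_one, inner_neg_left,
    real_inner_smul_left, sub_eq_add_neg]

theorem weightedDiff_antipodalPair (p q : ℝ) (w : Feat d) :
    weightedDiff p q (antipodalPair p q w) = (p ^ 2 + q ^ 2) • w := by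
  simp only [weightedDiff_apply, antipodalPair, Matrix.cons_val_zero, Matrix.cons_val_one]
  module

theorem inv_smul_antipodalPair (c p q : ℝ) (w : Feat d) :
    c⁻¹ • antipodalPair p q w = antipodalPair (p / c) (q / c) w := by
  ext e : 1
  fin_cases e <;> simp [antipodalPair, smul_smul, div_eq_inv_mul]

theorem IsMinNorm.preimage_weightedDiff {S : Set (Feat d)} {w : Feat d} (hw : IsMinNorm S w) {p : ℝ}
    (hp : 0 < p) (q : ℝ) : IsMinNorm (weightedDiff p q ⁻¹' S)
      (antipodalPair (p / (p ^ 2 + q ^ 2)) (q / (p ^ 2 + q ^ 2)) w) := by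
  rw [← inv_smul_antipodalPair, ← adjoint_weightedDiff]
  refine hw.preimage (by positivity) fun u => ?_
  rw [adjoint_weightedDiff, weightedDiff_antipodalPair]

variable (δ : Fin 2 → ℝ) (h : Fin n → Feat d) (y : Fin n → Fin 2)

theorem erase_eq_singleton_rev (c : Fin 2) : Finset.univ.erase c = {c.rev} := by
  decide +revert

theorem ne_iff_eq_rev (c e : Fin 2) : c ≠ e ↔ c = e.rev := by
  decide +revert

theorem signLabel_mul_inner_weightedDiff (c : Fin 2) (W : Classifier d 2) (z : Feat d) :
    signLabel c * ⟪weightedDiff (δ 0) (δ 1) W, z⟫_ℝ =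
      ⟪δ c • W c - δ c.rev • W c.rev, z⟫_ℝ := by
  rw [weightedDiff_apply, ← real_inner_smul_left]
  congr 1
  fin_cases c <;> simp [signLabel]

theorem signLabel_mul_mul_inner_weightedDiff_one (c : Fin 2) (τ : ℝ) (W : Classifier d 2)
    (z : Feat d) : signLabel c * τ * ⟪weightedDiff 1 1 W, z⟫_ℝ = τ * ⟪W c - W c.rev, z⟫_ℝ := by
  rw [mul_right_comm, mul_comm τ]
  simpa only [one_smul] using
    congrArg (· * τ) (signLabel_mul_inner_weightedDiff (fun _ => 1) c W z)

theorem inner_vsFeature (w : Feat d) (i : Fin n) :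
    ⟪w, vsFeature δ h y i⟫_ℝ = signLabel (y i) * δ (y i) * ⟪w, h i⟫_ℝ := by
  rw [vsFeature, inner_smul_right]

theorem vsFeasible_eq_marginSet : vsFeasible δ h y = marginSet (vsFeature δ h y) := by
  simp only [vsFeasible, marginSet, inner_vsFeature]

theorem ceFeasible_eq_vsFeasible : ceFeasible h y = vsFeasible 1 h y := by
  simp only [ceFeasible, vsFeasible, Pi.one_apply, mul_one]

theorem cdtFeasible_eq_preimage :
    cdtFeasible δ h y = weightedDiff (δ 0) (δ 1) ⁻¹' ceFeasible h y := by
  ext W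
  simp only [cdtFeasible, ceFeasible, Set.mem_preimage, Set.mem_ofPred_eq, ne_iff_eq_rev, forall_eq,
    signLabel_mul_inner_weightedDiff]

theorem ldtFeasible_eq_preimage :
    ldtFeasible δ h y = weightedDiff 1 1 ⁻¹' vsFeasible δ h y := by
  ext W
  simp only [ldtFeasible, vsFeasible, Set.mem_preimage, Set.mem_ofPred_eq, ne_iff_eq_rev, forall_eq,
    signLabel_mul_mul_inner_weightedDiff_one]

theorem vsLoss_eq_logitLoss (ι ω : Fin 2 → ℝ) : vsLoss δ ι ω h y =
    logitLoss (fun i => ω (y i)) (fun i => ι (y i)) (vsFeature δ h y) := by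
  ext w
  simp only [vsLoss, logitLoss, softplus, inner_vsFeature, sub_eq_add_neg, Real.exp_add]

theorem ceLoss_eq_vsLoss : ceLoss h y = vsLoss 1 0 1 h y := by
  ext w
  simp only [ceLoss, vsLoss, Pi.one_apply, Pi.zero_apply, Real.exp_zero, one_mul, mul_one]

theorem cdtLoss_eq_ceLoss_comp : cdtLoss δ h y = ceLoss h y ∘ weightedDiff (δ 0) (δ 1) := by
  ext W
  simp only [cdtLoss, ceLoss, Function.comp_apply, erase_eq_singleton_rev, Finset.sum_singleton,
    signLabel_mul_inner_weightedDiff]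

theorem ldtLoss_eq_vsLoss_comp : ldtLoss δ h y = vsLoss δ 0 1 h y ∘ weightedDiff 1 1 := by
  ext W
  simp only [ldtLoss, vsLoss, Function.comp_apply, erase_eq_singleton_rev, Finset.sum_singleton,
    Pi.one_apply, Pi.zero_apply, Real.exp_zero, one_mul,
    signLabel_mul_mul_inner_weightedDiff_one]

variable {δ h y}

theorem convex_vsFeasible : Convex ℝ (vsFeasible δ h y) := by
  rw [vsFeasible_eq_marginSet]
  exact convex_marginSet _

theorem convex_ceFeasible : Convex ℝ (ceFeasible h y) := by
  rw [ceFeasible_eq_vsFeasible]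
  exact convex_vsFeasible

theorem convex_cdtFeasible : Convex ℝ (cdtFeasible δ h y) := by
  rw [cdtFeasible_eq_preimage]
  exact convex_ceFeasible.linear_preimage (weightedDiff (δ 0) (δ 1)).toLinearMap

theorem convex_ldtFeasible : Convex ℝ (ldtFeasible δ h y) := by
  rw [ldtFeasible_eq_preimage]
  exact convex_vsFeasible.linear_preimage (weightedDiff 1 1).toLinearMap

theorem exists_isMinNorm_vsFeasible (hsep : Separable h y) (hδ : ∀ c, 0 < δ c) :
    ∃ w, IsMinNorm (vsFeasible δ h y) w := by
  obtain ⟨u, hu⟩ := hsep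
  rw [vsFeasible_eq_marginSet]
  refine exists_isMinNorm_marginSet (w := u) fun i => ?_
  rw [inner_vsFeature, mul_right_comm]
  exact mul_pos (hu i) (hδ _)

theorem exists_isMinNorm_ceFeasible (hsep : Separable h y) : ∃ w, IsMinNorm (ceFeasible h y) w := by
  rw [ceFeasible_eq_vsFeasible]
  exact exists_isMinNorm_vsFeasible hsep fun _ => one_pos

theorem isMinNorm_cdtFeasible {w : Feat d} (hw : IsMinNorm (ceFeasible h y) w) (hδ : 0 < δ 0) :
    IsMinNorm (cdtFeasible δ h y) (antipodalPair (δ 0 / (δ 0 ^ 2 + δ 1 ^ 2))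
      (δ 1 / (δ 0 ^ 2 + δ 1 ^ 2)) w) := by
  rw [cdtFeasible_eq_preimage]
  exact hw.preimage_weightedDiff hδ (δ 1)

theorem isMinNorm_ldtFeasible {w : Feat d} (hw : IsMinNorm (vsFeasible δ h y) w) :
    IsMinNorm (ldtFeasible δ h y) (antipodalPair (1 / 2) (1 / 2) w) := by
  rw [ldtFeasible_eq_preimage]
  convert hw.preimage_weightedDiff one_pos 1 using 2 <;> norm_num

variable [Nonempty (Fin n)]

theorem isTrained_vsLoss {ι ω : Fin 2 → ℝ} (hω : ∀ c, 0 < ω c) {w : Feat d}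
    (hw : IsMinNorm (vsFeasible δ h y) w) : IsTrained (vsLoss δ ι ω h y) (‖w‖⁻¹ • w) := by
  rw [vsFeasible_eq_marginSet] at hw
  rw [vsLoss_eq_logitLoss]
  exact isTrained_logitLoss hw fun i => hω (y i)

theorem isTrained_ceLoss {w : Feat d} (hw : IsMinNorm (ceFeasible h y) w) :
    IsTrained (ceLoss h y) (‖w‖⁻¹ • w) := by
  rw [ceFeasible_eq_vsFeasible] at hw
  rw [ceLoss_eq_vsLoss]
  exact isTrained_vsLoss (fun _ => one_pos) hw

theorem isTrained_cdtLoss {W : Classifier d 2} (hW : IsMinNorm (cdtFeasible δ h y) W) :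
    IsTrained (cdtLoss δ h y) (‖W‖⁻¹ • W) := by
  rw [cdtFeasible_eq_preimage, ceFeasible_eq_vsFeasible, vsFeasible_eq_marginSet] at hW
  rw [cdtLoss_eq_ceLoss_comp, ceLoss_eq_vsLoss, vsLoss_eq_logitLoss]
  exact isTrained_logitLoss_comp hW fun _ => one_pos

theorem isTrained_ldtLoss {W : Classifier d 2} (hW : IsMinNorm (ldtFeasible δ h y) W) :
    IsTrained (ldtLoss δ h y) (‖W‖⁻¹ • W) := by
  rw [ldtFeasible_eq_preimage, vsFeasible_eq_marginSet] at hW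
  rw [ldtLoss_eq_vsLoss_comp, vsLoss_eq_logitLoss]
  exact isTrained_logitLoss_comp hW fun _ => one_pos

end Features

section Rule

variable {d : ℕ}

theorem binaryRule_smul {c : ℝ} (hc : 0 < c) (w x : Feat d) :
    binaryRule (c • w) x = binaryRule w x := by
  rw [binaryRule, binaryRule, real_inner_smul_left, sign_mul, sign_pos hc, one_mul]

theorem twoClassRule_eq_binaryRule (W : Classifier d 2) (x : Feat d) :
    twoClassRule W x = binaryRule (W 0 - W 1) x := rfl

theorem binaryRule_inv_norm_smul (w x : Feat d) : binaryRule (‖w‖⁻¹ • w) x = binaryRule w x := by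
  obtain rfl | hw := eq_or_ne w 0
  · rw [smul_zero]
  · exact binaryRule_smul (inv_pos.2 (norm_pos_iff.2 hw)) w x

theorem twoClassRule_inv_norm_smul (W : Classifier d 2) (x : Feat d) :
    twoClassRule (‖W‖⁻¹ • W) x = twoClassRule W x := by
  obtain rfl | hW := eq_or_ne W 0
  · rw [smul_zero]
  · rw [twoClassRule_eq_binaryRule, PiLp.smul_apply, PiLp.smul_apply, ← smul_sub,
      binaryRule_smul (inv_pos.2 (norm_pos_iff.2 hW)), ← twoClassRule_eq_binaryRule]

theorem twoClassRule_antipodalPair {p q : ℝ} (hpq : 0 < p + q) (w x : Feat d) :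
    twoClassRule (antipodalPair p q w) x = binaryRule w x := by
  rw [← binaryRule_smul hpq, add_smul, ← sub_neg_eq_add]
  rfl

end Rule

theorem mainTheorem1 {d n : ℕ} (hn : 0 < n) (h : Fin n → Feat d) (y : Fin n → Fin 2)
    (hsep : Separable h y) (δ : Fin 2 → ℝ) (hδ : ∀ c, 0 < δ c)
    (ι ω : Fin 2 → ℝ) (hω : ∀ c, 0 < ω c) :
    -- LDT gives the rule of the binary VS loss with the same `δ`
    (∀ (W : Classifier d 2) (w : Feat d),
      IsTrained (ldtLoss δ h y) W → IsTrained (vsLoss δ ι ω h y) w →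
        ∀ x, twoClassRule W x = binaryRule w x) ∧
    -- CDT gives the rule of binary CE, whatever `δ`
    (∀ (W : Classifier d 2) (w : Feat d),
      IsTrained (cdtLoss δ h y) W → IsTrained (ceLoss h y) w →
        ∀ x, twoClassRule W x = binaryRule w x) ∧
    -- the four trained classifiers exist: they are the directions of the max-margin solutions,
    -- which are unique and related explicitly
    ∃ (Wldt Wcdt : Classifier d 2) (wce wvs : Feat d),
      (∀ W, IsMinNorm (ldtFeasible δ h y) W ↔ W = Wldt) ∧
      (∀ W, IsMinNorm (cdtFeasible δ h y) W ↔ W = Wcdt) ∧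
      (∀ w, IsMinNorm (ceFeasible h y) w ↔ w = wce) ∧
      (∀ w, IsMinNorm (vsFeasible δ h y) w ↔ w = wvs) ∧
      IsTrained (ldtLoss δ h y) (‖Wldt‖⁻¹ • Wldt) ∧
      IsTrained (cdtLoss δ h y) (‖Wcdt‖⁻¹ • Wcdt) ∧
      IsTrained (ceLoss h y) (‖wce‖⁻¹ • wce) ∧
      IsTrained (vsLoss δ ι ω h y) (‖wvs‖⁻¹ • wvs) ∧
      Wldt 0 = (1 / 2 : ℝ) • wvs ∧ Wldt 1 = -((1 / 2 : ℝ) • wvs) ∧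
      Wcdt 0 = (δ 0 / (δ 0 ^ 2 + δ 1 ^ 2)) • wce ∧
      Wcdt 1 = -((δ 1 / (δ 0 ^ 2 + δ 1 ^ 2)) • wce) := by
  have : Nonempty (Fin n) := ⟨⟨0, hn⟩⟩
  obtain ⟨wvs, hvs⟩ := exists_isMinNorm_vsFeasible hsep hδ
  obtain ⟨wce, hce⟩ := exists_isMinNorm_ceFeasible hsep
  have hldt := isMinNorm_ldtFeasible hvs
  have hcdt := isMinNorm_cdtFeasible hce (hδ 0)
  refine ⟨fun W w hW hw x => ?_, fun W w hW hw x => ?_, _, _, wce, wvs,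
    hldt.iff_eq convex_ldtFeasible, hcdt.iff_eq convex_cdtFeasible, hce.iff_eq convex_ceFeasible,
    hvs.iff_eq convex_vsFeasible, isTrained_ldtLoss hldt, isTrained_cdtLoss hcdt,
    isTrained_ceLoss hce, isTrained_vsLoss hω hvs, rfl, rfl, rfl, rfl⟩
  · rw [hW.unique (isTrained_ldtLoss hldt), hw.unique (isTrained_vsLoss hω hvs),
      twoClassRule_inv_norm_smul, binaryRule_inv_norm_smul]
    exact twoClassRule_antipodalPair (by norm_num) wvs x
  · rw [hW.unique (isTrained_cdtLoss hcdt), hw.unique (isTrained_ceLoss hce),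
      twoClassRule_inv_norm_smul, binaryRule_inv_norm_smul]
    have hδ₀ := hδ 0
    have hδ₁ := hδ 1
    exact twoClassRule_antipodalPair (by positivity) wce x
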